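/- For a Borel probability measure $\mu$ on $\mathbb R$ and $t>0$, let $C_t\mu$ be its contraction, $C_t\mu(A)=\int 1_A(tx)\,d\mu(x)$ for Borel sets $A\subset\mathbb R$, and for a function $f$ on $\mathbb R$ let $(C_t\mu\ast f)(y)=\int f(y-x)\,d(C_t\mu)(x)=\int f(y-tx)\,d\mu(x)$. The measure $\mu$ is called a Rajchman measure if $\widehat\mu(n)=\int e^{-2\pi i n x}\,d\mu(x)\to 0$ as $|n|\to\infty$, $n\in\mathbb Z$. A sequence of probability measures $(\mu_k)$ on $\mathbb R$ is an approximate identity if $\|\mu_k\ast f-f\|_{L^1(\mathbb R)}\to 0$ for every $f\in L^1(\mathbb R)$. There exist a Borel probability measure $\mu_0$ on $\mathbb R$ supported in $[0,1]$, which is continuous (has no point masses) and is not a Rajchman measure, and a sequence of positive numbers $t_k\to 0$, such that the contractions $C_{t_k}\mu_0$ form an approximate identity and, for every $f\in L^2[0,1]$ (extended by zero to $\mathbb R$), the convolutions $C_{t_k}\mu_0\ast f$ are defined almost everywhere by absolutely convergent integrals and $$\lim_{k\to\infty} C_{t_k}\mu_0\ast f(y)=f(y)\quad\text{for Lebesgue-almost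 every } y\in\mathbb R .$$ -/

import Mathlib

open MeasureTheory Filter Topology Set

noncomputable section

/-- The Fourier transform `s ↦ ∫ exp (-2πi s x) dμ(x)` of a finite Borel measure on `ℝ`. -/
def measureFourier (μ : Measure ℝ) (s : ℝ) : ℂ :=
  ∫ x : ℝ, Complex.exp (-2 * Real.pi * Complex.I * s * x) ∂μ

/-- A Rajchman measure: a Borel probability measure whose Fourier transform on the integers
tends to `0` as `|n| → ∞`. -/
def IsRajchman (μ : Measure ℝ) : Prop :=
  IsProbabilityMeasure μ ∧
    Tendsto (fun n : ℤ => measureFourier μ (n : ℝ)) cofinite (𝓝 0)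

/-- The contraction `C_t μ`, that is, `(C_t μ)(A) = ∫ 1_A (t x) dμ(x)` for Borel sets `A`. -/
def contraction (t : ℝ) (μ : Measure ℝ) : Measure ℝ :=
  μ.map (fun x : ℝ => t * x)

/-- The convolution `(μ ∗ f)(y) = ∫ f (y - x) dμ(x)`. -/
def measureConv (μ : Measure ℝ) (f : ℝ → ℂ) (y : ℝ) : ℂ :=
  ∫ x : ℝ, f (y - x) ∂μ

/-- A sequence of probability measures on `ℝ` is an approximate identity on `L¹(ℝ)` if
`‖μ_k ∗ f - f‖₁ → 0` for every `f` in `L¹(ℝ)`. -/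
def IsApproximateIdentity (μ : ℕ → Measure ℝ) : Prop :=
  (∀ k, IsProbabilityMeasure (μ k)) ∧
    ∀ f : ℝ → ℂ, MemLp f 1 volume →
      Tendsto (fun k => eLpNorm (fun y => measureConv (μ k) f y - f y) 1 volume) atTop (𝓝 0)

/-- The extension by zero to `ℝ` of a function on `[0,1]`. -/
def zeroExtend (f : ℝ → ℂ) : ℝ → ℂ :=
  (Icc (0 : ℝ) 1).indicator f

end

/-!
The measure is the law `μ` of a uniform random point of `[0, 1]` in which the binary digits at the
sparse positions `4 ^ j` have been replaced by zeros (`sparseDigitMeasure`); the contraction factors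
are `t k = 2 ^ (-2 * 4 ^ k)`. Let `ν` be the uniform distribution on `[0, 1]`.

Almost everywhere convergence is obtained by comparing `C_t μ ∗ f` with `C_t ν ∗ f`, the average of
`f` over `[y - t, y]`, which converges to `f y` by Lebesgue's differentiation theorem. The
difference is controlled by its square function. Deleting one digit, at position `n`, changes the
Fourier transform at `ξ` by at most `2π min (|ξ| / 2 ^ n) (2 ^ n / |ξ|)`
(`norm_partialFourier_succ_sub_le`): a digit of weight `2⁻ⁿ` is invisible to low frequencies, while
the densities before and after the deletion are constant on dyadic intervals of length `2⁻ⁿ` and so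
have little high frequency content. At the scale `t k` the bound becomes the same one with `2 ^ n`
replaced by `2 ^ (2 * 4 ^ k + 4 ^ j)`. These powers of two are pairwise distinct, hence the sum over
all `k` and `j` is bounded uniformly in `ξ`
(`tsum_enorm_sq_measureFourier_contraction_sub_le`). By Parseval's identity, applied with period
`2` since all the functions vanish off `[0, 2]`, the sum over `k` of the squared `L²` norms of
`C_{t k} μ ∗ f - C_{t k} ν ∗ f` is finite, so these differences tend to zero almost everywhere
(`ae_tendsto_measureConv_sub_zero`).

The measure `μ` has no atoms because the deletions up to position `4 ^ J` only translate
`2 ^ 4 ^ J` intervals while the later ones move points by far less than `2 ^ (-4 ^ J)`. It is not a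
Rajchman measure because at the frequency `2 ^ (4 ^ J - 1)` the missing digit at position `4 ^ J`
confines the phase to a half circle, which gives the limit `2 / (πi)`
(`partialFourier_succ_half`). Any contractions of a fixed probability measure by factors tending to
zero form an approximate identity (`isApproximateIdentity_contraction`).
-/

/-! ### Characters -/

noncomputable section

/-- The character `x ↦ exp (-2πi ξ x)`. -/
def fourierKernel (ξ x : ℝ) : ℂ := Complex.exp (-2 * Real.pi * Complex.I * ξ * x)

end

theorem continuous_fourierKernel (ξ : ℝ) : Continuous (fourierKernel ξ) := by
  unfold fourierKernel; fun_prop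

theorem norm_fourierKernel (ξ x : ℝ) : ‖fourierKernel ξ x‖ = 1 := by
  rw [fourierKernel, Complex.norm_exp]; simp

/-! ### Convolution with a measure -/

theorem aestronglyMeasurable_comp_sub {f : ℝ → ℂ} (hf : AEStronglyMeasurable f volume)
    (μ : Measure ℝ) [SFinite μ] :
    AEStronglyMeasurable (fun p : ℝ × ℝ => f (p.1 - p.2)) ((volume : Measure ℝ).prod μ) :=
  hf.comp_quasiMeasurePreserving (quasiMeasurePreserving_sub_of_right_invariant volume μ)

theorem integrable_comp_sub {f : ℝ → ℂ} (hf : Integrable f volume)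
    (μ : Measure ℝ) [IsFiniteMeasure μ] :
    Integrable (fun p : ℝ × ℝ => f (p.1 - p.2)) ((volume : Measure ℝ).prod μ) := by
  simpa using Integrable.convolution_integrand (ContinuousLinearMap.mul ℝ ℂ)
    (integrable_const (1 : ℂ)) hf

theorem ae_integrable_comp_sub {f : ℝ → ℂ} (hf : Integrable f volume)
    (μ : Measure ℝ) [IsFiniteMeasure μ] :
    ∀ᵐ y ∂(volume : Measure ℝ), Integrable (fun x => f (y - x)) μ :=
  (integrable_comp_sub hf μ).prod_right_ae

theorem integrable_measureConv {f : ℝ → ℂ} (hf : Integrable f volume)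
    (μ : Measure ℝ) [IsFiniteMeasure μ] : Integrable (measureConv μ f) volume :=
  (integrable_comp_sub hf μ).integral_prod_left

/-- The Fourier transform takes convolution with a measure to a product. -/
theorem integral_measureConv_mul_exp {f : ℝ → ℂ} (hf : Integrable f volume)
    (μ : Measure ℝ) [IsFiniteMeasure μ] (s : ℝ) :
    ∫ y : ℝ, Complex.exp (-2 * Real.pi * Complex.I * s * y) * measureConv μ f y =
      measureFourier μ s * ∫ y : ℝ, Complex.exp (-2 * Real.pi * Complex.I * s * y) * f y := by
  have hnorm (z : ℝ) : ‖Complex.exp (-2 * Real.pi * Complex.I * s * z)‖ = 1 :=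
    norm_fourierKernel s z
  have hint : Integrable (fun p : ℝ × ℝ =>
      Complex.exp (-2 * Real.pi * Complex.I * s * p.1) * f (p.1 - p.2))
      ((volume : Measure ℝ).prod μ) := by
    refine (integrable_comp_sub hf μ).bdd_mul (c := 1) ?_ ?_
    · exact (by fun_prop : Continuous fun p : ℝ × ℝ =>
        Complex.exp (-2 * Real.pi * Complex.I * s * p.1)).aestronglyMeasurable
    · exact Eventually.of_forall fun p => (hnorm p.1).le
  simp only [measureConv, ← integral_const_mul (μ := μ)]
  rw [integral_integral_swap hint, measureFourier, ← integral_mul_const (μ := μ)]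
  refine integral_congr_ae (Eventually.of_forall fun x => ?_)
  simp only
  rw [← integral_add_right_eq_self _ x, ← integral_const_mul]
  refine integral_congr_ae (Eventually.of_forall fun y => ?_)
  simp only [add_sub_cancel_right, ← mul_assoc, ← Complex.exp_add]
  push_cast
  ring_nf

/-- Convolution with a probability measure preserves square integrability, by Jensen's
inequality. -/
theorem memLp_two_measureConv {f : ℝ → ℂ} (hf : Integrable f volume) (hf2 : MemLp f 2 volume)
    (μ : Measure ℝ) [IsProbabilityMeasure μ] : MemLp (measureConv μ f) 2 volume := by
  refine ⟨(integrable_measureConv hf μ).aestronglyMeasurable, ?_⟩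
  refine (eLpNorm_lt_top_iff_lintegral_rpow_enorm_lt_top two_ne_zero ENNReal.ofNat_ne_top).2 ?_
  have hf' := (eLpNorm_lt_top_iff_lintegral_rpow_enorm_lt_top two_ne_zero
    ENNReal.ofNat_ne_top).1 hf2.2
  refine lt_of_le_of_lt ?_ hf'
  have hm := (aestronglyMeasurable_comp_sub hf.aestronglyMeasurable μ).enorm.pow_const
    (2 : ENNReal).toReal
  calc ∫⁻ y, ‖measureConv μ f y‖ₑ ^ (2 : ENNReal).toReal
      ≤ ∫⁻ y, ∫⁻ x, ‖f (y - x)‖ₑ ^ (2 : ENNReal).toReal ∂μ := by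
        refine lintegral_mono_ae ?_
        filter_upwards [ae_integrable_comp_sub hf μ] with y hy
        have h := eLpNorm_le_eLpNorm_of_exponent_le (μ := μ) (p := 1) (q := 2) (by norm_num)
          hy.aestronglyMeasurable
        rw [eLpNorm_one_eq_lintegral_enorm,
          eLpNorm_eq_lintegral_rpow_enorm_toReal two_ne_zero ENNReal.ofNat_ne_top] at h
        have h2 := (enorm_integral_le_lintegral_enorm (μ := μ) (fun x => f (y - x))).trans h
        calc ‖measureConv μ f y‖ₑ ^ (2 : ENNReal).toReal
            ≤ ((∫⁻ x, ‖f (y - x)‖ₑ ^ (2 : ENNReal).toReal ∂μ) ^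
                (1 / (2 : ENNReal).toReal)) ^ (2 : ENNReal).toReal := by
              gcongr
              exact h2
          _ = ∫⁻ x, ‖f (y - x)‖ₑ ^ (2 : ENNReal).toReal ∂μ := by
              rw [← ENNReal.rpow_mul]; simp
    _ = ∫⁻ x, ∫⁻ y, ‖f (y - x)‖ₑ ^ (2 : ENNReal).toReal ∂volume ∂μ :=
        lintegral_lintegral_swap hm
    _ = ∫⁻ x, ∫⁻ y, ‖f y‖ₑ ^ (2 : ENNReal).toReal ∂volume ∂μ := by
        refine lintegral_congr fun x => ?_
        exact lintegral_sub_right_eq_self (fun y => ‖f y‖ₑ ^ (2 : ENNReal).toReal) x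
    _ = ∫⁻ y, ‖f y‖ₑ ^ (2 : ENNReal).toReal ∂volume := by simp

/-- Translation is continuous in `L¹`. -/
theorem tendsto_lintegral_enorm_sub_translate {f : ℝ → ℂ} (hf : MemLp f 1 volume) :
    Tendsto (fun s : ℝ => ∫⁻ y, ‖f (y - s) - f y‖ₑ) (𝓝 0) (𝓝 0) := by
  have hmp (s : ℝ) : MeasurePreserving (fun y : ℝ => y - s) volume volume :=
    measurePreserving_sub_right volume s
  have h1 : Tendsto (fun s : ℝ => Lp.compMeasurePreserving (fun y : ℝ => y - s) (hmp s)
      hf.toLp) (𝓝 0) (𝓝 (Lp.compMeasurePreserving (fun y : ℝ => y - 0) (hmp 0) hf.toLp)) := by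
    exact ((continuous_const (y := hf.toLp)).compMeasurePreservingLp
      (ContinuousMap.mk (fun a : ℝ × ℝ ↦ a.2 - a.1) (by fun_prop)).curry.continuous hmp
      (by simp)).tendsto 0
  have h2 := tendsto_iff_edist_tendsto_0.1 h1
  refine h2.congr fun s => ?_
  rw [Lp.edist_def, eLpNorm_one_eq_lintegral_enorm]
  refine lintegral_congr_ae ?_
  have e1 := Lp.coeFn_compMeasurePreserving hf.toLp (hmp s)
  have e2 := Lp.coeFn_compMeasurePreserving hf.toLp (hmp 0)
  have e3 := (hmp s).quasiMeasurePreserving.ae_eq_comp hf.coeFn_toLp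
  have e4 := (hmp 0).quasiMeasurePreserving.ae_eq_comp hf.coeFn_toLp
  filter_upwards [e1, e2, e3, e4] with y h1 h2 h3 h4
  simp only [Function.comp_apply, Pi.sub_apply, sub_zero] at h1 h2 h3 h4 ⊢
  rw [h1, h2, h3, h4]

/-! ### Contractions -/

instance isProbabilityMeasure_contraction (t : ℝ) (μ : Measure ℝ) [IsProbabilityMeasure μ] :
    IsProbabilityMeasure (contraction t μ) :=
  Measure.isProbabilityMeasure_map (by fun_prop)

theorem measureFourier_contraction (t : ℝ) (μ : Measure ℝ) (s : ℝ) :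
    measureFourier (contraction t μ) s = measureFourier μ (t * s) := by
  rw [measureFourier, contraction, integral_map (by fun_prop)]
  · simp only [measureFourier]
    congr with x
    push_cast
    ring_nf
  · exact (by fun_prop : Continuous fun x : ℝ =>
      Complex.exp (-2 * Real.pi * Complex.I * s * x)).aestronglyMeasurable

/-- Contractions of a fixed probability measure by factors tending to `0` form an approximate
identity, by continuity of translation in `L¹`. -/
theorem isApproximateIdentity_contraction (μ : Measure ℝ) [IsProbabilityMeasure μ]
    {t : ℕ → ℝ} (ht : Tendsto t atTop (𝓝 0)) :
    IsApproximateIdentity (fun k => contraction (t k) μ) := by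
  refine ⟨fun k => inferInstance, fun f hf => ?_⟩
  have hfi : Integrable f volume := memLp_one_iff_integrable.1 hf
  set ω : ℝ → ENNReal := fun s => ∫⁻ y, ‖f (y - s) - f y‖ₑ with hω
  have hmeas (ν : Measure ℝ) [IsProbabilityMeasure ν] : AEMeasurable
      (fun p : ℝ × ℝ => ‖f (p.1 - p.2) - f p.1‖ₑ) ((volume : Measure ℝ).prod ν) :=
    ((aestronglyMeasurable_comp_sub hf.1 ν).sub hf.1.comp_fst).enorm
  have hωm : Measurable ω := by
    -- `f` is only almost everywhere measurable, but `ω` depends on its class only.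
    have hω' : ω = fun s => ∫⁻ y, ‖hf.1.mk f (y - s) - hf.1.mk f y‖ₑ := by
      funext s
      refine lintegral_congr_ae ?_
      filter_upwards [hf.1.ae_eq_mk, (measurePreserving_sub_right volume
        s).quasiMeasurePreserving.ae_eq_comp hf.1.ae_eq_mk] with y h1 h2
      simp only [Function.comp_apply] at h2
      rw [h1, h2]
    have hg : Measurable (hf.1.mk f) := hf.1.stronglyMeasurable_mk.measurable
    rw [hω']
    exact Measurable.lintegral_prod_right' (f := fun p : ℝ × ℝ =>
      ‖hf.1.mk f (p.2 - p.1) - hf.1.mk f p.2‖ₑ) (by fun_prop)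
  have hle (k : ℕ) : eLpNorm (fun y => measureConv (contraction (t k) μ) f y - f y) 1 volume ≤
      ∫⁻ x, ω (t k * x) ∂μ := by
    set ν := contraction (t k) μ with hν
    calc eLpNorm (fun y => measureConv ν f y - f y) 1 volume
        = ∫⁻ y, ‖measureConv ν f y - f y‖ₑ := eLpNorm_one_eq_lintegral_enorm
      _ ≤ ∫⁻ y, ∫⁻ x, ‖f (y - x) - f y‖ₑ ∂ν := by
          refine lintegral_mono_ae ?_
          filter_upwards [ae_integrable_comp_sub hfi ν] with y hy
          have : measureConv ν f y - f y = ∫ x, (f (y - x) - f y) ∂ν := by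
            rw [integral_sub hy (integrable_const _)]; simp [measureConv]
          rw [this]
          exact enorm_integral_le_lintegral_enorm _
      _ = ∫⁻ x, ω x ∂ν := lintegral_lintegral_swap (hmeas ν)
      _ = ∫⁻ x, ω (t k * x) ∂μ := lintegral_map hωm (by fun_prop)
  refine tendsto_of_tendsto_of_tendsto_of_le_of_le tendsto_const_nhds ?_ (fun _ => zero_le)
    hle
  have hbound (s : ℝ) : ω s ≤ 2 * ∫⁻ y, ‖f y‖ₑ := by
    calc ω s ≤ ∫⁻ y, (‖f (y - s)‖ₑ + ‖f y‖ₑ) := lintegral_mono fun y => enorm_sub_le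
      _ = (∫⁻ y, ‖f (y - s)‖ₑ) + ∫⁻ y, ‖f y‖ₑ := lintegral_add_right' _ hf.1.enorm
      _ = 2 * ∫⁻ y, ‖f y‖ₑ := by
          rw [lintegral_sub_right_eq_self (fun y => ‖f y‖ₑ) s, two_mul]
  have := tendsto_lintegral_filter_of_dominated_convergence (μ := μ) (l := atTop)
    (F := fun k x => ω (t k * x)) (f := fun _ => 0) (fun _ => 2 * ∫⁻ y, ‖f y‖ₑ) ?_ ?_ ?_ ?_
  · simpa using this
  · exact Eventually.of_forall fun k => hωm.comp (measurable_const_mul (t k))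
  · exact Eventually.of_forall fun k => Eventually.of_forall fun x => hbound _
  · simpa using ENNReal.mul_ne_top (by simp) hfi.2.ne
  · refine Eventually.of_forall fun x => ?_
    refine (tendsto_lintegral_enorm_sub_translate hf).comp ?_
    simpa using ht.mul_const x

/-! ### The square function -/

/-- Parseval's identity with period `2`, for a function on the line that vanishes off `[0, 2]`. -/
theorem tsum_enorm_sq_integral_exp_mul {g : ℝ → ℂ} (hg : MemLp g 2 volume)
    (hsupp : ∀ y, y ∉ Icc (0 : ℝ) 2 → g y = 0) :
    ∑' n : ℤ, ‖∫ y : ℝ, Complex.exp (-2 * Real.pi * Complex.I * ((n / 2 : ℝ) : ℂ) * y) *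
      g y‖ₑ ^ 2 = 2 * ∫⁻ y, ‖g y‖ₑ ^ 2 := by
  have hP := hasSum_sq_fourierCoeffOn (f := g) (zero_lt_two (α := ℝ)) (hg.restrict _)
  have hc (n : ℤ) : fourierCoeffOn (zero_lt_two (α := ℝ)) g n = (1 / 2 : ℝ) •
      ∫ y : ℝ, Complex.exp (-2 * Real.pi * Complex.I * ((n / 2 : ℝ) : ℂ) * y) * g y := by
    rw [fourierCoeffOn_eq_integral, intervalIntegral.integral_of_le zero_le_two,
      ← integral_Icc_eq_integral_Ioc, setIntegral_eq_integral_of_forall_compl_eq_zero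
        (fun y hy => by rw [hsupp y hy, smul_zero]), sub_zero]
    congr 2 with y
    rw [fourier_coe_apply, smul_eq_mul]
    push_cast
    congr 2
    ring
  have hint : Integrable (fun y => ‖g y‖ ^ 2) volume := hg.integrable_norm_pow two_ne_zero
  have h2 : ∫ y in (0 : ℝ)..2, ‖g y‖ ^ 2 = ∫ y, ‖g y‖ ^ 2 := by
    rw [intervalIntegral.integral_of_le zero_le_two, ← integral_Icc_eq_integral_Ioc]
    exact setIntegral_eq_integral_of_forall_compl_eq_zero fun y hy => by simp [hsupp y hy]
  have h3 : HasSum (fun n : ℤ => ‖∫ y : ℝ, Complex.exp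
      (-2 * Real.pi * Complex.I * ((n / 2 : ℝ) : ℂ) * y) * g y‖ ^ 2)
      (2 * ∫ y, ‖g y‖ ^ 2) := by
    have := hP.mul_left 4
    simp only [hc, norm_smul, mul_pow, h2] at this
    have e : (4 : ℝ) * ((2 - 0 : ℝ)⁻¹ • ∫ y, ‖g y‖ ^ 2) = 2 * ∫ y, ‖g y‖ ^ 2 := by
      rw [smul_eq_mul]; ring
    rw [e] at this
    refine Eq.mp (congrArg (fun F : ℤ → ℝ => HasSum F _) (funext fun n => ?_)) this
    norm_num [← mul_assoc]
  have h4 := ENNReal.ofReal_tsum_of_nonneg (fun n => sq_nonneg _) h3.summable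
  rw [h3.tsum_eq, ENNReal.ofReal_mul zero_le_two,
    ofReal_integral_eq_lintegral_ofReal hint (Eventually.of_forall fun y => sq_nonneg _)] at h4
  simp only [ENNReal.ofReal_pow (norm_nonneg _), ofReal_norm] at h4
  rw [← h4]
  simp

theorem measureConv_eq_zero_of_notMem {μ : Measure ℝ} (hμ : μ (Icc (0 : ℝ) 1)ᶜ = 0) {f : ℝ → ℂ}
    (hf : ∀ y, y ∉ Icc (0 : ℝ) 1 → f y = 0) {y : ℝ} (hy : y ∉ Icc (0 : ℝ) 2) :
    measureConv μ f y = 0 := by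
  refine integral_eq_zero_of_ae ?_
  filter_upwards [compl_mem_ae_iff.2 hμ] with x hx
  rw [compl_compl] at hx
  refine hf _ fun h => hy ?_
  constructor <;> linarith [h.1, h.2, hx.1, hx.2]

/-- If the Fourier transforms of two sequences of probability measures on `[0, 1]` are square
summably close, uniformly in the frequency, then the difference of the convolutions with a square
integrable function tends to `0` almost everywhere: by Parseval's identity the square function of
the differences is integrable. -/
theorem ae_tendsto_measureConv_sub_zero {μ ν : ℕ → Measure ℝ} [∀ k, IsProbabilityMeasure (μ k)]
    [∀ k, IsProbabilityMeasure (ν k)] (hμ : ∀ k, μ k (Icc (0 : ℝ) 1)ᶜ = 0)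
    (hν : ∀ k, ν k (Icc (0 : ℝ) 1)ᶜ = 0) {C : ENNReal} (hC : C ≠ ⊤)
    (hsum : ∀ s : ℝ, ∑' k, ‖measureFourier (μ k) s - measureFourier (ν k) s‖ₑ ^ 2 ≤ C)
    {f : ℝ → ℂ} (hf1 : Integrable f volume) (hf2 : MemLp f 2 volume)
    (hf : ∀ y, y ∉ Icc (0 : ℝ) 1 → f y = 0) :
    ∀ᵐ y ∂(volume : Measure ℝ),
      Tendsto (fun k => measureConv (μ k) f y - measureConv (ν k) f y) atTop (𝓝 0) := by
  set D : ℕ → ℝ → ℂ := fun k y => measureConv (μ k) f y - measureConv (ν k) f y with hD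
  have hDm (k : ℕ) : MemLp (D k) 2 volume :=
    (memLp_two_measureConv hf1 hf2 (μ k)).sub (memLp_two_measureConv hf1 hf2 (ν k))
  have hDs (k : ℕ) : ∀ y, y ∉ Icc (0 : ℝ) 2 → D k y = 0 := fun y hy => by
    simp only [hD, measureConv_eq_zero_of_notMem (hμ k) hf hy,
      measureConv_eq_zero_of_notMem (hν k) hf hy, sub_zero]
  have hexp (s : ℝ) {g : ℝ → ℂ} (hg : Integrable g volume) : Integrable
      (fun y : ℝ => Complex.exp (-2 * Real.pi * Complex.I * s * y) * g y) volume := by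
    refine hg.bdd_mul (c := 1) (continuous_fourierKernel s).aestronglyMeasurable
      (Eventually.of_forall fun y => ?_)
    exact (norm_fourierKernel s y).le
  have hDF (k : ℕ) (s : ℝ) :
      ∫ y : ℝ, Complex.exp (-2 * Real.pi * Complex.I * s * y) * D k y =
      (measureFourier (μ k) s - measureFourier (ν k) s) *
        ∫ y : ℝ, Complex.exp (-2 * Real.pi * Complex.I * s * y) * f y := by
    simp only [hD, mul_sub]
    rw [integral_sub (hexp s (integrable_measureConv hf1 _))
      (hexp s (integrable_measureConv hf1 _)), integral_measureConv_mul_exp hf1,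
      integral_measureConv_mul_exp hf1, sub_mul]
  have hfs : ∀ y, y ∉ Icc (0 : ℝ) 2 → f y = 0 := fun y hy =>
    hf y fun h => hy ⟨h.1, h.2.trans one_le_two⟩
  have hfin : ∫⁻ y, ‖f y‖ₑ ^ 2 ≠ ⊤ := by
    have := (eLpNorm_lt_top_iff_lintegral_rpow_enorm_lt_top two_ne_zero
      ENNReal.ofNat_ne_top).1 hf2.2
    simpa using this.ne
  have hm (k : ℕ) : AEMeasurable (fun y => ‖D k y‖ₑ ^ 2) volume := (hDm k).1.enorm.pow_const 2
  have key : 2 * ∫⁻ y, ∑' k, ‖D k y‖ₑ ^ 2 ≤ C * (2 * ∫⁻ y, ‖f y‖ₑ ^ 2) := by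
    rw [lintegral_tsum hm, ← ENNReal.tsum_mul_left]
    have hk (k : ℕ) := (tsum_enorm_sq_integral_exp_mul (hDm k) (hDs k)).symm
    rw [tsum_congr hk, ← tsum_enorm_sq_integral_exp_mul hf2 hfs]
    simp only [hDF, enorm_mul, mul_pow]
    rw [ENNReal.tsum_comm, ← ENNReal.tsum_mul_left]
    refine ENNReal.tsum_le_tsum fun n => ?_
    rw [ENNReal.tsum_mul_right]
    gcongr
    exact hsum _
  have hfin2 : ∫⁻ y, ∑' k, ‖D k y‖ₑ ^ 2 ≠ ⊤ := by
    intro h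
    rw [h] at key
    exact (ENNReal.mul_lt_top hC.lt_top (ENNReal.mul_lt_top ENNReal.ofNat_lt_top hfin.lt_top)).ne
      (top_le_iff.1 (by simpa [ENNReal.mul_top] using key))
  filter_upwards [ae_lt_top' (AEMeasurable.tsum hm) hfin2] with y hy
  have h0 := ENNReal.tendsto_atTop_zero_of_tsum_ne_top hy.ne
  have h1 : Tendsto (fun k => (‖D k y‖ₑ ^ 2) ^ (1 / 2 : ℝ)) atTop (𝓝 (0 ^ (1 / 2 : ℝ))) :=
    (ENNReal.continuous_rpow_const.tendsto 0).comp h0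
  rw [tendsto_zero_iff_enorm_tendsto_zero]
  rw [ENNReal.zero_rpow_of_pos (by norm_num)] at h1
  refine h1.congr fun k => ?_
  rw [← ENNReal.rpow_natCast, ← ENNReal.rpow_mul]
  norm_num
  rfl

/-! ### Uniform averages -/

/-- Lebesgue's differentiation theorem for averages over `[y - t, y]`. -/
theorem ae_tendsto_measureConv_contraction_volume {f : ℝ → ℂ} (hf : Integrable f volume)
    {t : ℕ → ℝ} (htpos : ∀ k, 0 < t k) (ht : Tendsto t atTop (𝓝 0)) :
    ∀ᵐ y ∂(volume : Measure ℝ), Tendsto (fun k => measureConv (contraction (t k)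
      (volume.restrict (Icc (0 : ℝ) 1))) f y) atTop (𝓝 (f y)) := by
  have hcontr (k : ℕ) : contraction (t k) (volume.restrict (Icc (0 : ℝ) 1)) =
      ENNReal.ofReal (t k)⁻¹ • volume.restrict (Icc 0 (t k)) := by
    have he : MeasurableEmbedding (fun x : ℝ => t k * x) :=
      (Homeomorph.mulLeft₀ (t k) (htpos k).ne').measurableEmbedding
    have hpre : (fun x : ℝ => t k * x) ⁻¹' (Icc 0 (t k)) = Icc 0 1 := by
      ext x
      have := htpos k
      simp only [mem_preimage, mem_Icc, mul_nonneg_iff_of_pos_left this,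
        mul_le_iff_le_one_right this]
    rw [contraction, ← hpre, ← he.restrict_map, Real.map_volume_mul_left (htpos k).ne',
      Measure.restrict_smul, abs_of_pos (inv_pos.2 (htpos k))]
  filter_upwards [IsUnifLocDoublingMeasure.ae_tendsto_average (μ := (volume : Measure ℝ))
    hf.locallyIntegrable 1] with y hy
  have h := hy (l := atTop) (fun k => y - t k / 2) (fun k => t k / 2) ?_ ?_
  · refine h.congr fun k => ?_
    have htk := htpos k
    rw [measureConv, hcontr, integral_smul_measure, setAverage_eq, Real.closedBall_eq_Icc,
      Real.volume_real_Icc_of_le (by linarith), ENNReal.toReal_ofReal (inv_pos.2 htk).le]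
    congr 1
    · congr 1; ring
    · rw [integral_Icc_eq_integral_Ioc, integral_Icc_eq_integral_Ioc,
        ← intervalIntegral.integral_of_le (by linarith),
        ← intervalIntegral.integral_of_le (by linarith),
        intervalIntegral.integral_comp_sub_left (fun x => f x) y]
      congr 1 <;> ring
  · refine tendsto_nhdsWithin_iff.2 ⟨by simpa using ht.div_const 2, ?_⟩
    exact Eventually.of_forall fun k => half_pos (htpos k)
  · refine Eventually.of_forall fun k => ?_
    have htk := htpos k
    rw [Metric.mem_closedBall, Real.dist_eq]
    rw [sub_sub_cancel, abs_of_pos (half_pos htk), one_mul]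

/-! ### Deleting binary digits -/

noncomputable section

/-- The `n`-th binary digit of `u` (the digit of weight `2⁻ⁿ`), as a real number. -/
def binaryDigit (n : ℕ) (u : ℝ) : ℝ := ((⌊2 ^ n * u⌋ % 2 : ℤ) : ℝ)

/-- The part of `u` carried by its binary digits at the first `J` of the positions `4 ^ j`. -/
def deletedPart (J : ℕ) (u : ℝ) : ℝ :=
  ∑ j ∈ Finset.range J, binaryDigit (4 ^ j) u / 2 ^ 4 ^ j

/-- The number obtained from `u` by setting to zero all the binary digits at the positions
`4 ^ j`. -/
def deleteDigits (u : ℝ) : ℝ := u - ∑' j : ℕ, binaryDigit (4 ^ j) u / 2 ^ 4 ^ j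

/-- The law of a uniform random point of `[0, 1]` whose binary digits at the positions `4 ^ j` have
been replaced by zeros. -/
def sparseDigitMeasure : Measure ℝ := (volume.restrict (Icc (0 : ℝ) 1)).map deleteDigits

end

theorem binaryDigit_nonneg (n : ℕ) (u : ℝ) : 0 ≤ binaryDigit n u := by
  unfold binaryDigit
  exact_mod_cast Int.emod_nonneg _ two_ne_zero

theorem binaryDigit_le_one (n : ℕ) (u : ℝ) : binaryDigit n u ≤ 1 := by
  unfold binaryDigit
  have : ⌊2 ^ n * u⌋ % 2 ≤ 1 := by omega
  exact_mod_cast this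

theorem measurable_binaryDigit (n : ℕ) : Measurable (binaryDigit n) := by
  unfold binaryDigit
  exact (measurable_from_top (f := fun k : ℤ => ((k % 2 : ℤ) : ℝ))).comp
    (Int.measurable_floor.comp (by fun_prop))

/-- Truncating at an earlier position is an integer division of the later truncation. -/
theorem floor_two_pow_mul {m n : ℕ} (h : m ≤ n) (u : ℝ) :
    ⌊2 ^ m * u⌋ = ⌊2 ^ n * u⌋ / 2 ^ (n - m) := by
  have := Int.floor_div_natCast (2 ^ n * u) (2 ^ (n - m))
  push_cast at this
  rw [← this]
  congr 1
  rw [eq_div_iff (by positivity), mul_right_comm, ← pow_add, Nat.add_sub_cancel' h]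

theorem measurable_deletedPart (J : ℕ) : Measurable (deletedPart J) := by
  unfold deletedPart
  exact Finset.measurable_fun_sum _ fun j _ => (measurable_binaryDigit _).div_const _

/-- The part carried by digits up to position `n` is constant on dyadic intervals of length
`2⁻ⁿ`. -/
theorem exists_deletedPart_eq {J n : ℕ} (h : ∀ j < J, 4 ^ j ≤ n) :
    ∃ ψ : ℤ → ℝ, ∀ u, deletedPart J u = ψ ⌊2 ^ n * u⌋ := by
  refine ⟨fun k => ∑ j ∈ Finset.range J, ((k / 2 ^ (n - 4 ^ j) % 2 : ℤ) : ℝ) / 2 ^ 4 ^ j,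
    fun u => ?_⟩
  refine Finset.sum_congr rfl fun j hj => ?_
  rw [binaryDigit, floor_two_pow_mul (h j (Finset.mem_range.1 hj))]

theorem floor_two_pow_succ_mul (n : ℕ) (u : ℝ) :
    (⌊2 ^ (n + 1) * u⌋ : ℝ) = 2 * ⌊2 ^ n * u⌋ + binaryDigit (n + 1) u := by
  rw [binaryDigit, floor_two_pow_mul n.le_succ]
  simp only [Nat.succ_eq_add_one, Nat.add_sub_cancel_left, pow_one]
  exact_mod_cast (Int.mul_ediv_add_emod _ 2).symm

theorem floor_two_pow_div_le {m n : ℕ} (h : m ≤ n) (u : ℝ) :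
    (⌊2 ^ m * u⌋ : ℝ) / 2 ^ m ≤ ⌊2 ^ n * u⌋ / 2 ^ n := by
  induction n, h using Nat.le_induction with
  | base => exact le_rfl
  | succ n _ ih =>
    refine ih.trans ?_
    rw [floor_two_pow_succ_mul, pow_succ', add_div, mul_div_mul_left _ _ two_ne_zero]
    have := binaryDigit_nonneg (n + 1) u
    linarith [div_nonneg this (by positivity : (0 : ℝ) ≤ 2 * 2 ^ n)]

theorem four_pow_lt_of_lt {j J n : ℕ} (hj : j < J) (hn : 4 ^ J ≤ n) : 4 ^ j ≤ n - 1 :=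
  Nat.le_sub_one_of_lt ((Nat.pow_lt_pow_right (by norm_num) hj).trans_le hn)

/-- Deleted digits up to position `n` contribute at most the truncation of `u` at position `n`. -/
theorem deletedPart_le_floor {u : ℝ} (hu : 0 ≤ u) (J : ℕ) :
    ∀ n, (∀ j < J, 4 ^ j ≤ n) → deletedPart J u ≤ ⌊2 ^ n * u⌋ / 2 ^ n := by
  induction J with
  | zero =>
    intro n _
    simp only [deletedPart, Finset.range_zero, Finset.sum_empty]
    have : (0 : ℝ) ≤ ⌊2 ^ n * u⌋ := by exact_mod_cast Int.floor_nonneg.2 (by positivity)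
    positivity
  | succ J ih =>
    intro n hn
    obtain ⟨m, hm⟩ : ∃ m, 4 ^ J = m + 1 := Nat.exists_eq_succ_of_ne_zero (by positivity)
    have h1 := ih m fun j hj => by simpa [hm] using four_pow_lt_of_lt hj le_rfl
    refine le_trans ?_ (floor_two_pow_div_le (hn J J.lt_succ_self) u)
    rw [deletedPart, Finset.sum_range_succ, ← deletedPart, hm, floor_two_pow_succ_mul, add_div]
    refine add_le_add (h1.trans_eq ?_) le_rfl
    rw [pow_succ', mul_div_mul_left _ _ two_ne_zero]

theorem deletedPart_le {u : ℝ} (hu : 0 ≤ u) (J : ℕ) : deletedPart J u ≤ u := by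
  refine (deletedPart_le_floor hu J (4 ^ J) fun j hj =>
    Nat.pow_le_pow_right (by norm_num) hj.le).trans ?_
  rw [div_le_iff₀ (by positivity), mul_comm u]
  exact Int.floor_le _

theorem binaryDigit_div_le (J i : ℕ) (u : ℝ) :
    binaryDigit (4 ^ (i + J)) u / 2 ^ 4 ^ (i + J) ≤ (1 / 2) ^ i * (1 / 2 ^ 4 ^ J) := by
  have h : i + 4 ^ J ≤ 4 ^ (i + J) := by
    rw [pow_add]
    have h1 : i + 1 ≤ 4 ^ i := Nat.lt_pow_self (by norm_num)
    have h2 : 1 ≤ 4 ^ J := Nat.one_le_pow _ _ (by norm_num)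
    nlinarith
  rw [one_div_pow, one_div_mul_one_div, ← pow_add]
  exact div_le_div₀ zero_le_one (binaryDigit_le_one _ _) (by positivity)
    (pow_le_pow_right₀ one_le_two h)

theorem summable_binaryDigit (u : ℝ) :
    Summable fun j : ℕ => binaryDigit (4 ^ j) u / 2 ^ 4 ^ j :=
  Summable.of_nonneg_of_le (fun j => div_nonneg (binaryDigit_nonneg _ _) (by positivity))
    (fun j => binaryDigit_div_le 0 j u)
    ((summable_geometric_of_lt_one (by norm_num) (by norm_num)).mul_right _)

theorem tendsto_deletedPart (u : ℝ) :
    Tendsto (fun J => u - deletedPart J u) atTop (𝓝 (deleteDigits u)) :=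
  (summable_binaryDigit u).hasSum.tendsto_sum_nat.const_sub u

theorem measurable_deleteDigits : Measurable deleteDigits :=
  measurable_of_tendsto_metrizable (fun J => measurable_id.sub (measurable_deletedPart J))
    (tendsto_pi_nhds.2 tendsto_deletedPart)

theorem abs_deleteDigits_sub_le (J : ℕ) (u : ℝ) :
    |deleteDigits u - (u - deletedPart J u)| ≤ 2 / 2 ^ 4 ^ J := by
  have hs := summable_binaryDigit u
  have hs' := (summable_nat_add_iff J).2 hs
  have h0 := hs.sum_add_tsum_nat_add J
  have hg := (hasSum_geometric_two).mul_right (1 / 2 ^ 4 ^ J : ℝ)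
  have h1 := hs'.tsum_le_tsum (fun i => binaryDigit_div_le J i u) hg.summable
  rw [hg.tsum_eq] at h1
  have h2 : 0 ≤ ∑' i, binaryDigit (4 ^ (i + J)) u / 2 ^ 4 ^ (i + J) :=
    tsum_nonneg fun i => div_nonneg (binaryDigit_nonneg _ _) (by positivity)
  rw [deleteDigits, deletedPart, ← h0, abs_le, div_eq_mul_one_div]
  constructor <;> linarith

theorem deleteDigits_mem_Icc {u : ℝ} (hu : u ∈ Icc (0 : ℝ) 1) :
    deleteDigits u ∈ Icc (0 : ℝ) 1 := by
  refine isClosed_Icc.mem_of_tendsto (tendsto_deletedPart u) (Eventually.of_forall fun J => ?_)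
  have h1 := deletedPart_le hu.1 J
  have h2 : 0 ≤ deletedPart J u :=
    Finset.sum_nonneg fun i _ => div_nonneg (binaryDigit_nonneg _ _) (by positivity)
  constructor <;> linarith [hu.2]

instance isProbabilityMeasure_restrict_Icc :
    IsProbabilityMeasure (volume.restrict (Icc (0 : ℝ) 1)) :=
  ⟨by simp⟩

instance isProbabilityMeasure_sparseDigitMeasure : IsProbabilityMeasure sparseDigitMeasure :=
  Measure.isProbabilityMeasure_map measurable_deleteDigits.aemeasurable

theorem sparseDigitMeasure_compl_Icc : sparseDigitMeasure (Icc (0 : ℝ) 1)ᶜ = 0 := by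
  rw [sparseDigitMeasure, Measure.map_apply measurable_deleteDigits measurableSet_Icc.compl]
  refine measure_mono_null (fun u hu h => hu (deleteDigits_mem_Icc h)) (t := (Icc (0 : ℝ) 1)ᶜ) ?_
  simp

/-! ### Absence of atoms -/

/-- A map that is a translation on each dyadic interval of length `1 / M` pulls an interval of
length `2 ε` back to a set of measure at most `2 (M + 1) ε`. -/
theorem volume_setOf_abs_sub_floor_le (M : ℕ) (ψ : ℤ → ℝ) (x ε : ℝ) :
    volume.restrict (Icc (0 : ℝ) 1) {u : ℝ | |u - ψ ⌊M * u⌋ - x| ≤ ε} ≤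
      ENNReal.ofReal ((M + 1) * (2 * ε)) := by
  rw [Measure.restrict_apply' measurableSet_Icc]
  have hsub : {u : ℝ | |u - ψ ⌊M * u⌋ - x| ≤ ε} ∩ Icc (0 : ℝ) 1 ⊆
      ⋃ i ∈ Finset.range (M + 1), Icc (x + ψ i - ε) (x + ψ i + ε) := by
    rintro u ⟨hu, h0, h1⟩
    have hf0 : 0 ≤ ⌊(M : ℝ) * u⌋ := Int.floor_nonneg.2 (by positivity)
    have hf1 : ⌊(M : ℝ) * u⌋ ≤ M := by
      have := Int.floor_le_floor (mul_le_of_le_one_right (Nat.cast_nonneg (α := ℝ) M) h1)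
      simpa using this
    obtain ⟨i, hi⟩ := Int.eq_ofNat_of_zero_le hf0
    simp only [mem_ofPred_eq, hi, abs_le] at hu
    simp only [mem_iUnion]
    refine ⟨i, Finset.mem_range.2 (by omega), ?_, ?_⟩ <;> linarith [hu.1, hu.2]
  refine (measure_mono hsub).trans ((measure_biUnion_finset_le _ _).trans_eq ?_)
  simp only [Real.volume_Icc, add_sub_sub_cancel, Finset.sum_const, Finset.card_range,
    nsmul_eq_mul]
  rw [ENNReal.ofReal_mul (by positivity), ← two_mul]
  congr 1
  rw [← ENNReal.ofReal_natCast]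
  push_cast
  rfl

theorem tendsto_two_pow_four_pow : Tendsto (fun J : ℕ => (2 : ℝ) ^ 4 ^ J) atTop atTop :=
  (tendsto_pow_atTop_atTop_of_one_lt one_lt_two).comp
    (tendsto_pow_atTop_atTop_of_one_lt (by norm_num))

/-- The measure has no atoms: the first `J + 1` deletions translate each of the `2 ^ 4 ^ J` dyadic
intervals, the remaining ones move points by at most `2 / 2 ^ 4 ^ (J + 1)`, and
`2 ^ 4 ^ (J + 1)` is the fourth power of `2 ^ 4 ^ J`. -/
theorem sparseDigitMeasure_singleton (x : ℝ) : sparseDigitMeasure {x} = 0 := by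
  rw [sparseDigitMeasure, Measure.map_apply measurable_deleteDigits (measurableSet_singleton x)]
  have hbound (J : ℕ) : volume.restrict (Icc (0 : ℝ) 1) (deleteDigits ⁻¹' {x}) ≤
      ENNReal.ofReal (8 / 2 ^ 4 ^ J) := by
    obtain ⟨ψ, hψ⟩ := exists_deletedPart_eq (J := J + 1) (n := 4 ^ J)
      fun j hj => Nat.pow_le_pow_right (by norm_num) (Nat.lt_succ_iff.1 hj)
    have h := volume_setOf_abs_sub_floor_le (2 ^ 4 ^ J) ψ x (2 / 2 ^ 4 ^ (J + 1))
    refine (measure_mono fun u hu => ?_).trans (h.trans (ENNReal.ofReal_le_ofReal ?_))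
    · have h1 := abs_deleteDigits_sub_le (J + 1) u
      rw [mem_preimage, mem_singleton_iff] at hu
      rw [hu, hψ, abs_sub_comm] at h1
      simpa using h1
    · set a : ℝ := 2 ^ 4 ^ J with ha
      have h1 : (1 : ℝ) ≤ a := one_le_pow₀ one_le_two
      have h2 : (2 : ℝ) ^ 4 ^ (J + 1) = a ^ 4 := by rw [ha, ← pow_mul, pow_succ 4]
      have h3 : a ^ 2 ≤ a ^ 4 := pow_le_pow_right₀ h1 (by norm_num)
      rw [h2]
      push_cast
      calc (a + 1) * (2 * (2 / a ^ 4)) ≤ (2 * a) * (2 * (2 / a ^ 2)) := by gcongr; linarith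
        _ = 8 / a := by field_simp; norm_num
  have hlim : Tendsto (fun J : ℕ => ENNReal.ofReal (8 / 2 ^ 4 ^ J)) atTop (𝓝 0) := by
    have := ENNReal.tendsto_ofReal (tendsto_two_pow_four_pow.const_div_atTop 8)
    simpa using this
  exact le_antisymm (ge_of_tendsto' hlim hbound) zero_le

/-! ### Fourier estimates -/

noncomputable section

/-- The Fourier transform of the law of a uniform point of `[0, 1]` whose digits at the first `J`
of the positions `4 ^ j` are deleted. -/
def partialFourier (J : ℕ) (ξ : ℝ) : ℂ :=
  ∫ u in Icc (0 : ℝ) 1, fourierKernel ξ (u - deletedPart J u)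

end

theorem fourierKernel_add (ξ x y : ℝ) :
    fourierKernel ξ (x + y) = fourierKernel ξ x * fourierKernel ξ y := by
  simp only [fourierKernel, ← Complex.exp_add]
  push_cast
  ring_nf

theorem norm_fourierKernel_sub_le (ξ x y : ℝ) :
    ‖fourierKernel ξ x - fourierKernel ξ y‖ ≤ 2 * Real.pi * |ξ| * |x - y| := by
  have h : fourierKernel ξ x - fourierKernel ξ y =
      fourierKernel ξ y * (fourierKernel ξ (x - y) - 1) := by
    rw [mul_sub, ← fourierKernel_add, add_sub_cancel, mul_one]
  rw [h, norm_mul, norm_fourierKernel, one_mul]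
  have h2 : fourierKernel ξ (x - y) =
      Complex.exp (Complex.I * ((-(2 * Real.pi * ξ * (x - y)) : ℝ) : ℂ)) := by
    rw [fourierKernel]; push_cast; ring_nf
  rw [h2]
  refine Real.norm_exp_I_mul_ofReal_sub_one_le.trans_eq ?_
  rw [Real.norm_eq_abs, abs_neg, abs_mul, abs_mul, abs_of_pos Real.two_pi_pos]

theorem integrable_fourierKernel_comp {g : ℝ → ℝ} (hg : Measurable g) (ξ : ℝ) :
    Integrable (fun u => fourierKernel ξ (g u)) (volume.restrict (Icc (0 : ℝ) 1)) :=
  Integrable.of_bound ((continuous_fourierKernel ξ).measurable.comp hg).aestronglyMeasurable 1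
    (Eventually.of_forall fun u => (norm_fourierKernel ξ (g u)).le)

theorem measurable_sub_deletedPart (J : ℕ) : Measurable fun u : ℝ => u - deletedPart J u :=
  measurable_id.sub (measurable_deletedPart J)

theorem norm_intervalIntegral_fourierKernel_le {ξ : ℝ} (hξ : ξ ≠ 0) (a b : ℝ) :
    ‖∫ u in a..b, fourierKernel ξ u‖ ≤ 1 / (Real.pi * |ξ|) := by
  have hc : (-2 * Real.pi * Complex.I * ξ : ℂ) ≠ 0 := by
    simp [Real.pi_ne_zero, hξ]
  have hξ' := abs_pos.2 hξ
  have hπ := Real.pi_pos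
  have : ∫ u in a..b, fourierKernel ξ u =
      (fourierKernel ξ b - fourierKernel ξ a) / (-2 * Real.pi * Complex.I * ξ : ℂ) :=
    integral_exp_mul_complex hc
  rw [this, norm_div]
  have h1 : ‖(-2 * Real.pi * Complex.I * ξ : ℂ)‖ = 2 * Real.pi * |ξ| := by
    simp [abs_of_pos hπ]
  have h2 : ‖fourierKernel ξ b - fourierKernel ξ a‖ ≤ 2 := by
    refine (norm_sub_le _ _).trans ?_
    rw [norm_fourierKernel, norm_fourierKernel]; norm_num
  rw [h1, div_le_div_iff₀ (by positivity) (by positivity)]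
  nlinarith [mul_pos hπ hξ']

/-- High frequency bound: on each of the `M` intervals of length `1 / M` the phase is a translate
of a linear one, whose integral is at most `1 / (π |ξ|)`. -/
theorem norm_integral_fourierKernel_sub_floor_le {M : ℕ} (hM : 0 < M) (ψ : ℤ → ℝ) {ξ : ℝ}
    (hξ : ξ ≠ 0) :
    ‖∫ u in Icc (0 : ℝ) 1, fourierKernel ξ (u - ψ ⌊M * u⌋)‖ ≤ M / (Real.pi * |ξ|) := by
  have hM' : (0 : ℝ) < M := Nat.cast_pos.2 hM
  have hmeas : Measurable fun u : ℝ => u - ψ ⌊M * u⌋ :=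
    measurable_id.sub ((measurable_from_top (f := ψ)).comp
      (Int.measurable_floor.comp (measurable_const_mul _)))
  have hii (a b : ℝ) :
      IntervalIntegrable (fun u => fourierKernel ξ (u - ψ ⌊M * u⌋)) volume a b := by
    refine (intervalIntegrable_const (c := (1 : ℝ))).mono_fun
      ((continuous_fourierKernel ξ).measurable.comp hmeas).aestronglyMeasurable ?_
    exact Eventually.of_forall fun u => by simp [norm_fourierKernel]
  have hsum := intervalIntegral.sum_integral_adjacent_intervals (n := M)
    (a := fun i : ℕ => (i : ℝ) / M) fun i _ => hii _ _
  simp only [Nat.cast_zero, zero_div, div_self hM'.ne'] at hsum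
  rw [integral_Icc_eq_integral_Ioc, ← intervalIntegral.integral_of_le zero_le_one, ← hsum]
  refine (norm_sum_le _ _).trans ?_
  have hpiece (i : ℕ) :
      ‖∫ u in (i / M : ℝ)..((i + 1 : ℕ) / M : ℝ), fourierKernel ξ (u - ψ ⌊M * u⌋)‖ ≤
        1 / (Real.pi * |ξ|) := by
    have hle : (i / M : ℝ) ≤ ((i + 1 : ℕ) / M : ℝ) := by gcongr; simp
    have hcongr : ∫ u in (i / M : ℝ)..((i + 1 : ℕ) / M : ℝ), fourierKernel ξ (u - ψ ⌊M * u⌋) =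
        ∫ u in (i / M : ℝ)..((i + 1 : ℕ) / M : ℝ),
          fourierKernel ξ (-ψ i) * fourierKernel ξ u := by
      refine intervalIntegral.integral_congr_ae ?_
      -- The right endpoint belongs to the next interval.
      have hne : ∀ᵐ u ∂(volume : Measure ℝ), u ≠ ((i + 1 : ℕ) / M : ℝ) := by
        simp [ae_iff]
      filter_upwards [hne] with u hu1 hu2
      rw [uIoc_of_le hle] at hu2
      have h1 : (i : ℝ) < M * u := by
        have := (div_lt_iff₀ hM').1 hu2.1; linarith
      have h2 : M * u < i + 1 := by
        have := (lt_div_iff₀ hM').1 (lt_of_le_of_ne hu2.2 hu1)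
        push_cast at this; linarith
      have h3 : ⌊M * u⌋ = (i : ℤ) := Int.floor_eq_iff.2 ⟨by exact_mod_cast h1.le, by
        exact_mod_cast h2⟩
      rw [h3, ← fourierKernel_add, neg_add_eq_sub]
    rw [hcongr, intervalIntegral.integral_const_mul, norm_mul, norm_fourierKernel, one_mul]
    exact norm_intervalIntegral_fourierKernel_le hξ _ _
  refine (Finset.sum_le_sum fun i _ => hpiece i).trans_eq ?_
  rw [Finset.sum_const, Finset.card_range, nsmul_eq_mul, mul_one_div]

theorem norm_partialFourier_le {J n : ℕ} (h : ∀ j < J, 4 ^ j ≤ n) {ξ : ℝ} (hξ : ξ ≠ 0) :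
    ‖partialFourier J ξ‖ ≤ 2 ^ n / (Real.pi * |ξ|) := by
  obtain ⟨ψ, hψ⟩ := exists_deletedPart_eq h
  have := norm_integral_fourierKernel_sub_floor_le (M := 2 ^ n) (by positivity) ψ hξ
  simpa [partialFourier, hψ] using this

theorem measureFourier_sparseDigitMeasure (ξ : ℝ) :
    measureFourier sparseDigitMeasure ξ = ∫ u in Icc (0 : ℝ) 1, fourierKernel ξ (deleteDigits u) :=
  integral_map measurable_deleteDigits.aemeasurable
    (continuous_fourierKernel ξ).aestronglyMeasurable

theorem norm_measureFourier_sub_partialFourier_le (J : ℕ) (ξ : ℝ) :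
    ‖measureFourier sparseDigitMeasure ξ - partialFourier J ξ‖ ≤
      4 * Real.pi * |ξ| / 2 ^ 4 ^ J := by
  rw [measureFourier_sparseDigitMeasure, partialFourier, ← integral_sub
    (integrable_fourierKernel_comp measurable_deleteDigits ξ)
    (integrable_fourierKernel_comp (measurable_sub_deletedPart J) ξ)]
  have h := norm_integral_le_of_norm_le_const (μ := volume.restrict (Icc (0 : ℝ) 1))
    (f := fun u => fourierKernel ξ (deleteDigits u) - fourierKernel ξ (u - deletedPart J u))
    (C := 4 * Real.pi * |ξ| / 2 ^ 4 ^ J) (Eventually.of_forall fun u => ?_)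
  · simpa using h
  · refine (norm_fourierKernel_sub_le _ _ _).trans ?_
    calc _ ≤ 2 * Real.pi * |ξ| * (2 / 2 ^ 4 ^ J) := by
          gcongr
          exact abs_deleteDigits_sub_le J u
      _ = _ := by ring

theorem tendsto_partialFourier (ξ : ℝ) :
    Tendsto (fun J => partialFourier J ξ) atTop (𝓝 (measureFourier sparseDigitMeasure ξ)) := by
  rw [tendsto_iff_norm_sub_tendsto_zero]
  refine squeeze_zero (fun _ => norm_nonneg _) (fun J => ?_)
    (tendsto_two_pow_four_pow.const_div_atTop (4 * Real.pi * |ξ|))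
  rw [norm_sub_rev]
  exact norm_measureFourier_sub_partialFourier_le J ξ

/-- Deleting one more digit, of weight `2⁻ⁿ` with `n = 4 ^ J`, changes the Fourier transform
substantially only at frequencies comparable to `2ⁿ`: little below them since points move by at
most `2⁻ⁿ`, little above them since both densities are constant on the dyadic intervals of length
`2⁻ⁿ`. -/
theorem norm_partialFourier_succ_sub_le (J : ℕ) (ξ : ℝ) :
    ‖partialFourier (J + 1) ξ - partialFourier J ξ‖ ≤
      2 * Real.pi * min (|ξ| / 2 ^ 4 ^ J) (2 ^ 4 ^ J / |ξ|) := by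
  rcases eq_or_ne ξ 0 with rfl | hξ
  -- At `ξ = 0` the second term of the minimum is a division by zero, and the bound reads `0 ≤ 0`.
  · simp [partialFourier, fourierKernel]
  have hξ' := abs_pos.2 hξ
  have hπ := Real.pi_gt_three
  rw [mul_min_of_nonneg _ _ Real.two_pi_pos.le]
  refine le_min ?_ ?_
  · rw [partialFourier, partialFourier, ← integral_sub
      (integrable_fourierKernel_comp (measurable_sub_deletedPart _) ξ)
      (integrable_fourierKernel_comp (measurable_sub_deletedPart _) ξ)]
    have h := norm_integral_le_of_norm_le_const (μ := volume.restrict (Icc (0 : ℝ) 1))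
      (f := fun u => fourierKernel ξ (u - deletedPart (J + 1) u) -
        fourierKernel ξ (u - deletedPart J u))
      (C := 2 * Real.pi * (|ξ| / 2 ^ 4 ^ J)) (Eventually.of_forall fun u => ?_)
    · simpa using h
    · refine (norm_fourierKernel_sub_le _ _ _).trans ?_
      rw [mul_div_assoc', div_eq_mul_one_div (2 * Real.pi * |ξ|)]
      gcongr
      rw [sub_sub_sub_cancel_left, deletedPart, deletedPart, Finset.sum_range_succ,
        sub_add_cancel_left, abs_neg, abs_of_nonneg (div_nonneg (binaryDigit_nonneg _ _)
          (by positivity))]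
      gcongr
      exact binaryDigit_le_one _ _
  · have h1 := norm_partialFourier_le (J := J + 1) (n := 4 ^ J)
      (fun j hj => Nat.pow_le_pow_right (by norm_num) (Nat.lt_succ_iff.1 hj)) hξ
    have h2 := norm_partialFourier_le (J := J) (n := 4 ^ J)
      (fun j hj => Nat.pow_le_pow_right (by norm_num) hj.le) hξ
    have h3 : (2 : ℝ) ^ 4 ^ J / (Real.pi * |ξ|) ≤ Real.pi * (2 ^ 4 ^ J / |ξ|) := by
      rw [mul_div_assoc', div_le_div_iff₀ (by positivity) hξ']
      have : 0 < (2 : ℝ) ^ 4 ^ J * |ξ| := by positivity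
      nlinarith [mul_pos this (by linarith : 0 < Real.pi)]
    refine (norm_sub_le _ _).trans ?_
    linarith

theorem enorm_measureFourier_sub_le (ξ : ℝ) :
    ‖measureFourier sparseDigitMeasure ξ -
      measureFourier (volume.restrict (Icc (0 : ℝ) 1)) ξ‖ₑ ≤
      ∑' J : ℕ, ENNReal.ofReal (2 * Real.pi * min (|ξ| / 2 ^ 4 ^ J) (2 ^ 4 ^ J / |ξ|)) := by
  have h0 : partialFourier 0 ξ = measureFourier (volume.restrict (Icc (0 : ℝ) 1)) ξ := by
    simp [partialFourier, measureFourier, fourierKernel, deletedPart]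
  have := edist_le_tsum_of_edist_le_of_tendsto₀ (f := fun J => partialFourier J ξ)
    (fun J : ℕ => ENNReal.ofReal (2 * Real.pi * min (|ξ| / 2 ^ 4 ^ J) (2 ^ 4 ^ J / |ξ|)))
    (fun J => ?_) (tendsto_partialFourier ξ)
  · rwa [h0, edist_comm, edist_eq_enorm_sub] at this
  · rw [edist_comm, edist_eq_enorm_sub, ← ofReal_norm]
    exact ENNReal.ofReal_le_ofReal (norm_partialFourier_succ_sub_le J ξ)

/-- A sum over powers of two that decays geometrically on both sides of `|x|`. -/
theorem tsum_min_le (x : ℝ) :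
    ∑' n : ℕ, ENNReal.ofReal (min (|x| / 2 ^ n) (2 ^ n / |x|)) ≤ ENNReal.ofReal 4 := by
  set a := |x| with ha
  have ha0 : 0 ≤ a := abs_nonneg x
  have hgeo (m : ℕ) : ∑' n : ℕ, ENNReal.ofReal (a / 2 ^ (n + m)) =
      ENNReal.ofReal (2 * (a / 2 ^ m)) := by
    have h := hasSum_geometric_two.mul_right (a / 2 ^ m)
    rw [← h.tsum_eq, ENNReal.ofReal_tsum_of_nonneg (fun n => by positivity) h.summable]
    refine tsum_congr fun n => ?_
    congr 1
    rw [pow_add, one_div_pow]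
    field_simp
  by_cases h1 : a < 1
  · have h0 := hgeo 0
    simp only [add_zero, pow_zero, div_one] at h0
    refine (ENNReal.tsum_le_tsum fun n => ENNReal.ofReal_le_ofReal (min_le_left _ _)).trans ?_
    rw [h0]
    exact ENNReal.ofReal_le_ofReal (by linarith)
  -- Split at the largest `m` with `2 ^ m ≤ a`: geometric sums on both sides.
  · obtain ⟨m, hm1, hm2⟩ := exists_nat_pow_near (not_lt.1 h1) one_lt_two
    have ha1 : 0 < a := by linarith
    rw [← Summable.sum_add_tsum_nat_add' (k := m + 1) ENNReal.summable]
    have hA : ∑ n ∈ Finset.range (m + 1), ENNReal.ofReal (min (a / 2 ^ n) (2 ^ n / a)) ≤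
        ENNReal.ofReal 2 := by
      rw [← ENNReal.ofReal_sum_of_nonneg fun n _ => by positivity]
      refine ENNReal.ofReal_le_ofReal ?_
      calc _ ≤ ∑ n ∈ Finset.range (m + 1), (2 : ℝ) ^ n / a :=
            Finset.sum_le_sum fun n _ => min_le_right _ _
        _ ≤ 2 := by
            rw [← Finset.sum_div, geom_sum_eq (by norm_num), div_le_iff₀ ha1, pow_succ]
            linarith
    have hB : ∑' n : ℕ, ENNReal.ofReal (min (a / 2 ^ (n + (m + 1))) (2 ^ (n + (m + 1)) / a)) ≤
        ENNReal.ofReal 2 := by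
      calc _ ≤ ∑' n : ℕ, ENNReal.ofReal (a / 2 ^ (n + (m + 1))) :=
            ENNReal.tsum_le_tsum fun n => ENNReal.ofReal_le_ofReal (min_le_left _ _)
        _ ≤ ENNReal.ofReal 2 := by
            rw [hgeo]
            refine ENNReal.ofReal_le_ofReal ?_
            have := (div_le_one (by positivity : (0 : ℝ) < 2 ^ (m + 1))).2 hm2.le
            linarith
    calc _ ≤ ENNReal.ofReal 2 + ENNReal.ofReal 2 := add_le_add hA hB
      _ = ENNReal.ofReal 4 := by rw [← ENNReal.ofReal_add] <;> norm_num

/-- The exponents `2 * 4 ^ k + 4 ^ j` are pairwise distinct (compare binary expansions). -/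
theorem injective_two_mul_four_pow_add :
    Function.Injective fun p : ℕ × ℕ => 2 * 4 ^ p.1 + 4 ^ p.2 := by
  suffices h : ∀ k j k' j' : ℕ, 2 * 4 ^ k + 4 ^ j = 2 * 4 ^ k' + 4 ^ j' → k = k' ∧ j = j' by
    rintro ⟨k, j⟩ ⟨k', j'⟩ e
    obtain ⟨rfl, rfl⟩ := h _ _ _ _ e
    rfl
  intro k
  induction k with
  | zero =>
    intro j k' j' e
    rcases k' with _ | k'
    · exact ⟨rfl, Nat.pow_right_injective (by norm_num : 2 ≤ 4)
        (by simpa using e)⟩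
    · rcases j with _ | j <;> rcases j' with _ | j' <;> simp only [pow_succ, pow_zero] at e <;>
        omega
  | succ k ih =>
    intro j k' j' e
    rcases k' with _ | k' <;> rcases j with _ | j <;> rcases j' with _ | j' <;>
      simp only [pow_succ, pow_zero] at e
    any_goals omega
    · have := Nat.pow_right_injective (by norm_num : 2 ≤ 4)
        (show 4 ^ k = 4 ^ k' by omega)
      simp [this]
    · obtain ⟨rfl, rfl⟩ := ih j k' j' (by omega)
      simp

/-- The key Fourier estimate: by the two-sided decay of the increments, and since the products of
the digit weights and the contraction factors are distinct powers of two, the transforms of the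
contracted measures are summably close to those of uniform distributions. -/
theorem tsum_enorm_sq_measureFourier_contraction_sub_le (s : ℝ) :
    ∑' k : ℕ, ‖measureFourier (contraction (1 / 2 ^ (2 * 4 ^ k)) sparseDigitMeasure) s -
      measureFourier (contraction (1 / 2 ^ (2 * 4 ^ k)) (volume.restrict (Icc (0 : ℝ) 1))) s‖ₑ ^ 2
      ≤ (ENNReal.ofReal (2 * Real.pi) * ENNReal.ofReal 4) ^ 2 := by
  set x : ℕ → ENNReal := fun k =>
    ‖measureFourier (contraction (1 / 2 ^ (2 * 4 ^ k)) sparseDigitMeasure) s -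
      measureFourier (contraction (1 / 2 ^ (2 * 4 ^ k)) (volume.restrict (Icc (0 : ℝ) 1))) s‖ₑ
  set g : ℕ → ENNReal := fun n => ENNReal.ofReal (min (|s| / 2 ^ n) (2 ^ n / |s|))
  have h1 : ∑' k, x k ≤ ENNReal.ofReal (2 * Real.pi) * ENNReal.ofReal 4 := by
    calc ∑' k, x k ≤ ∑' k : ℕ, ∑' j : ℕ, ENNReal.ofReal (2 * Real.pi) * g (2 * 4 ^ k + 4 ^ j) := by
          refine ENNReal.tsum_le_tsum fun k => ?_
          simp only [x, measureFourier_contraction]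
          refine (enorm_measureFourier_sub_le _).trans_eq (tsum_congr fun j => ?_)
          rw [ENNReal.ofReal_mul Real.two_pi_pos.le]
          congr 3
          · rw [abs_mul, abs_of_pos (by positivity), pow_add]; field_simp
          · rw [abs_mul, abs_of_pos (by positivity), pow_add]
            rw [one_div_mul_eq_div, div_div_eq_mul_div, mul_comm]
      _ = ENNReal.ofReal (2 * Real.pi) * ∑' p : ℕ × ℕ, g (2 * 4 ^ p.1 + 4 ^ p.2) := by
          rw [← ENNReal.tsum_mul_left, ENNReal.tsum_prod']
      _ ≤ ENNReal.ofReal (2 * Real.pi) * ∑' n, g n := by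
          gcongr
          exact ENNReal.tsum_comp_le_tsum_of_injective injective_two_mul_four_pow_add g
      _ ≤ _ := by
          gcongr
          exact tsum_min_le s
  calc ∑' k, x k ^ 2 ≤ ∑' k, x k * ∑' l, x l := by
        refine ENNReal.tsum_le_tsum fun k => ?_
        rw [sq]
        gcongr
        exact ENNReal.le_tsum k
    _ = (∑' k, x k) ^ 2 := by rw [ENNReal.tsum_mul_right, sq]
    _ ≤ _ := by gcongr

/-! ### Failure of the Rajchman property -/

/-- At frequency half the weight denominator of a deleted digit, the deletion of the digit makes
the phase equal to that of a fractional part. -/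
theorem fourierKernel_sub_deletedPart_succ (J : ℕ) (u : ℝ) :
    fourierKernel (2 ^ 4 ^ J / 2) (u - deletedPart (J + 1) u) =
      fourierKernel (1 / 2) (Int.fract (2 ^ 4 ^ J * u)) := by
  set M : ℝ := 2 ^ 4 ^ J with hM
  have hM0 : M ≠ 0 := by positivity
  obtain ⟨c, hc⟩ : ∃ c : ℤ, M * deletedPart J u = 2 * c := by
    refine ⟨∑ j ∈ Finset.range J, (⌊2 ^ 4 ^ j * u⌋ % 2) * 2 ^ (4 ^ J - 4 ^ j - 1), ?_⟩
    rw [deletedPart, Finset.mul_sum]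
    push_cast
    rw [Finset.mul_sum]
    refine Finset.sum_congr rfl fun j hj => ?_
    have hlt : 4 ^ j < 4 ^ J := Nat.pow_lt_pow_right (by norm_num) (Finset.mem_range.1 hj)
    have h2 : M = 2 * 2 ^ (4 ^ J - 4 ^ j - 1) * 2 ^ 4 ^ j := by
      rw [hM, ← pow_succ', ← pow_add]
      congr 1
      omega
    rw [h2, binaryDigit]
    field_simp
  have hd : (⌊M * u⌋ : ℝ) = 2 * (⌊M * u⌋ / 2 : ℤ) + binaryDigit (4 ^ J) u := by
    rw [binaryDigit, ← hM]
    have := (Int.mul_ediv_add_emod ⌊M * u⌋ 2).symm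
    generalize ⌊M * u⌋ = k at this
    exact_mod_cast this
  have hphase : M * (u - deletedPart (J + 1) u) =
      Int.fract (M * u) + 2 * ((⌊M * u⌋ / 2 - c : ℤ) : ℝ) := by
    rw [deletedPart, Finset.sum_range_succ, ← deletedPart, mul_sub, mul_add, hc,
      mul_div_cancel₀ _ hM0, Int.fract]
    push_cast
    linarith
  rw [fourierKernel, fourierKernel, Complex.exp_eq_exp_iff_exists_int]
  refine ⟨-(⌊M * u⌋ / 2 - c), ?_⟩
  have h := congrArg (fun r : ℝ => (r : ℂ)) hphase
  push_cast at h ⊢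
  linear_combination (-Real.pi * Complex.I) * h

theorem partialFourier_succ_half (J : ℕ) :
    partialFourier (J + 1) (2 ^ 4 ^ J / 2) = 2 / (Real.pi * Complex.I) := by
  set f : ℝ → ℂ := fun v => fourierKernel (1 / 2) (Int.fract v) with hf
  have hper : Function.Periodic f 1 := fun v => by simp only [hf, Int.fract_add_one]
  have hii (a b : ℝ) : IntervalIntegrable f volume a b := by
    refine (intervalIntegrable_const (c := (1 : ℝ))).mono_fun
      ((continuous_fourierKernel _).measurable.comp measurable_fract).aestronglyMeasurable ?_
    exact Eventually.of_forall fun u => by simp [hf, norm_fourierKernel]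
  have hM : ((2 : ℝ) ^ 4 ^ J) ≠ 0 := by positivity
  have hperint : ∫ v in (0 : ℝ)..2 ^ 4 ^ J, f v = (2 : ℝ) ^ 4 ^ J • ∫ v in (0 : ℝ)..1, f v := by
    have := hper.intervalIntegral_add_zsmul_eq (2 ^ 4 ^ J) 0 hii
    simp only [zsmul_eq_mul, zero_add, mul_one] at this
    push_cast at this
    rw [this, Complex.real_smul]
    push_cast
    rfl
  have hbase : ∫ v in (0 : ℝ)..1, f v = ∫ v in (0 : ℝ)..1, fourierKernel (1 / 2) v := by
    refine intervalIntegral.integral_congr_ae ?_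
    have hne : ∀ᵐ u ∂(volume : Measure ℝ), u ≠ (1 : ℝ) := by simp [ae_iff]
    filter_upwards [hne] with u hu1 hu2
    rw [uIoc_of_le zero_le_one] at hu2
    simp only [hf, Int.fract_eq_self.2 ⟨hu2.1.le, lt_of_le_of_ne hu2.2 hu1⟩]
  have hc : (-2 * Real.pi * Complex.I * (1 / 2 : ℝ) : ℂ) ≠ 0 := by simp [Real.pi_ne_zero]
  have hval : ∫ v in (0 : ℝ)..1, fourierKernel (1 / 2) v = 2 / (Real.pi * Complex.I) := by
    refine (integral_exp_mul_complex hc).trans ?_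
    have h1 : Complex.exp (-2 * Real.pi * Complex.I * (1 / 2 : ℝ) * (1 : ℝ)) = -1 := by
      rw [← Complex.exp_neg_pi_mul_I]; push_cast; ring_nf
    rw [h1]
    have hπ : (Real.pi : ℂ) ≠ 0 := by exact_mod_cast Real.pi_ne_zero
    have hI := Complex.I_ne_zero
    push_cast
    rw [mul_zero, Complex.exp_zero]
    field_simp
    norm_num
  simp only [partialFourier, fourierKernel_sub_deletedPart_succ]
  rw [integral_Icc_eq_integral_Ioc, ← intervalIntegral.integral_of_le zero_le_one,
    intervalIntegral.integral_comp_mul_left f hM, mul_zero, mul_one, hperint, smul_smul,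
    inv_mul_cancel₀ hM, one_smul, hbase, hval]

/-- At the integer frequencies `2 ^ (4 ^ J - 1)` the transform tends to `2 / (πi)`, which is not
zero. -/
theorem not_isRajchman_sparseDigitMeasure : ¬ IsRajchman sparseDigitMeasure := by
  rintro ⟨-, h⟩
  have hinj : Function.Injective fun J : ℕ => (2 : ℤ) ^ (4 ^ J - 1) := by
    intro i j hij
    have h1 := Int.pow_right_injective (a := 2) (by norm_num) hij
    have h2 : 1 ≤ 4 ^ i := Nat.one_le_pow _ _ (by norm_num)
    have h3 : 1 ≤ 4 ^ j := Nat.one_le_pow _ _ (by norm_num)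
    exact Nat.pow_right_injective (by norm_num : 2 ≤ 4) (by omega : 4 ^ i = 4 ^ j)
  have hlim := h.comp (Nat.cofinite_eq_atTop ▸ hinj.tendsto_cofinite)
  have hfreq (J : ℕ) : (((2 : ℤ) ^ (4 ^ J - 1) : ℤ) : ℝ) = 2 ^ 4 ^ J / 2 := by
    have h3 : 4 ^ J = (4 ^ J - 1) + 1 :=
      (Nat.sub_add_cancel (Nat.one_le_pow _ _ (by norm_num))).symm
    rw [eq_div_iff two_ne_zero]
    push_cast
    rw [← pow_succ, ← h3]
  have hlim2 : Tendsto (fun J : ℕ => measureFourier sparseDigitMeasure (2 ^ 4 ^ J / 2)) atTop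
      (𝓝 (2 / (Real.pi * Complex.I))) := by
    rw [tendsto_iff_norm_sub_tendsto_zero]
    refine squeeze_zero (fun _ => norm_nonneg _) (fun J => ?_)
      (tendsto_two_pow_four_pow.const_div_atTop (2 * Real.pi))
    rw [← partialFourier_succ_half J]
    refine (norm_measureFourier_sub_partialFourier_le _ _).trans ?_
    set a : ℝ := 2 ^ 4 ^ J with ha
    have h1 : (1 : ℝ) ≤ a := one_le_pow₀ one_le_two
    have h2 : (2 : ℝ) ^ 4 ^ (J + 1) = a ^ 4 := by rw [ha, ← pow_mul, pow_succ 4]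
    have h3 : a ^ 2 ≤ a ^ 4 := pow_le_pow_right₀ h1 (by norm_num)
    rw [h2, abs_of_pos (by positivity)]
    calc 4 * Real.pi * (a / 2) / a ^ 4 ≤ 4 * Real.pi * (a / 2) / a ^ 2 := by gcongr
      _ = 2 * Real.pi / a := by field_simp; norm_num
  have heq := tendsto_nhds_unique hlim2 (hlim.congr fun J => by
    simp only [Function.comp_apply, hfreq])
  simp [Real.pi_ne_zero] at heq

/-! ### Almost everywhere convergence -/

theorem contraction_compl_Icc {μ : Measure ℝ} (hμ : μ (Icc (0 : ℝ) 1)ᶜ = 0) {t : ℝ} (h0 : 0 ≤ t)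
    (h1 : t ≤ 1) : contraction t μ (Icc (0 : ℝ) 1)ᶜ = 0 := by
  rw [contraction, Measure.map_apply (by fun_prop) measurableSet_Icc.compl]
  refine measure_mono_null (t := (Icc (0 : ℝ) 1)ᶜ) (fun x hx h => hx ?_) hμ
  exact ⟨mul_nonneg h0 h.1, mul_le_one₀ h1 h.1 h.2⟩

theorem mainTheorem8 :
    ∃ (μ₀ : Measure ℝ) (t : ℕ → ℝ),
      IsProbabilityMeasure μ₀ ∧
      μ₀ (Icc (0 : ℝ) 1)ᶜ = 0 ∧
      (∀ x : ℝ, μ₀ {x} = 0) ∧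
      ¬ IsRajchman μ₀ ∧
      (∀ k, 0 < t k) ∧
      Tendsto t atTop (𝓝 0) ∧
      IsApproximateIdentity (fun k => contraction (t k) μ₀) ∧
      ∀ f : ℝ → ℂ, MemLp f 2 (volume.restrict (Icc (0 : ℝ) 1)) →
        ∀ᵐ y ∂(volume : Measure ℝ),
          (∀ k, Integrable (fun x => zeroExtend f (y - x)) (contraction (t k) μ₀)) ∧
          Tendsto (fun k => measureConv (contraction (t k) μ₀) (zeroExtend f) y) atTop
            (𝓝 (zeroExtend f y)) := by
  have htpos (k : ℕ) : (0 : ℝ) < 1 / 2 ^ (2 * 4 ^ k) := by positivity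
  have htle (k : ℕ) : (1 : ℝ) / 2 ^ (2 * 4 ^ k) ≤ 1 :=
    (div_le_one (by positivity)).2 (one_le_pow₀ one_le_two)
  have ht : Tendsto (fun k : ℕ => (1 : ℝ) / 2 ^ (2 * 4 ^ k)) atTop (𝓝 0) := by
    refine Tendsto.const_div_atTop ?_ 1
    exact (tendsto_pow_atTop_atTop_of_one_lt one_lt_two).comp
      ((tendsto_pow_atTop_atTop_of_one_lt (by norm_num)).const_mul_atTop' two_pos)
  refine ⟨sparseDigitMeasure, fun k => 1 / 2 ^ (2 * 4 ^ k), inferInstance,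
    sparseDigitMeasure_compl_Icc, sparseDigitMeasure_singleton,
    not_isRajchman_sparseDigitMeasure, htpos, ht, isApproximateIdentity_contraction _ ht, ?_⟩
  intro f hf
  have hf2 : MemLp (zeroExtend f) 2 volume := (memLp_indicator_iff_restrict measurableSet_Icc).2 hf
  have hf1 : Integrable (zeroExtend f) volume :=
    (integrable_indicator_iff measurableSet_Icc).2 (hf.integrable one_le_two)
  have hsub := ae_tendsto_measureConv_sub_zero
    (fun k => contraction_compl_Icc sparseDigitMeasure_compl_Icc (htpos k).le (htle k))
    (fun k => contraction_compl_Icc (μ := volume.restrict (Icc (0 : ℝ) 1)) (by simp)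
      (htpos k).le (htle k))
    (ENNReal.pow_ne_top (ENNReal.mul_ne_top ENNReal.ofReal_ne_top ENNReal.ofReal_ne_top))
    tsum_enorm_sq_measureFourier_contraction_sub_le hf1 hf2
    (fun y hy => indicator_of_notMem hy f)
  filter_upwards [hsub, ae_tendsto_measureConv_contraction_volume hf1 htpos ht,
    ae_all_iff.2 fun k : ℕ => ae_integrable_comp_sub hf1
      (contraction (1 / 2 ^ (2 * 4 ^ k)) sparseDigitMeasure)] with y h1 h2 h3
  exact ⟨h3, by simpa using h1.add h2⟩
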